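/- Let $X$ be a non-empty finite set, let $\Delta(X)\subset\mathbb{R}^{X}$ be the simplex of probability vectors on $X$, and let $\Delta^2(X)$ be the set of Borel probability measures on $\Delta(X)$. Let $\rho>0$ and $dt>0$, let $F,H:\Delta(X)\to\mathbb{R}$ and $f:\mathbb{R}\to\mathbb{R}$ be continuous functions with $F\ge 0$ and $f\ge 0$, and let $C\ge 0$. If $C=0$, assume in addition that $H$ is strictly concave (as, for example, Shannon entropy is). Then there exists a unique continuous function $V:\Delta(X)\to\mathbb{R}$ such that, for every $\mu\in\Delta(X)$, $$V(\mu)=\max\Big\{F(\mu),\ \sup_{P}\ e^{-\rho\,dt}\,E_P[V(\nu)]-f\big(E_P[H(\mu)-H(\nu)]\big)\Big\},$$ where the supremum (which is finite) is taken over all $P\in\Delta^2(X)$ that satisfy $$E_P[\nu]=\mu\qquad\text{and}\qquad E_P[H(\mu)-H(\nu)]\le C,$$ and $\nu\in\Delta(X)$ denotes the random posterior with law $P$. -/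

import Mathlib

open MeasureTheory

noncomputable section

namespace InfoDesign

/-- `Δ(X)`: probability vectors on the finite state space `X`, with the topology and the Borel
σ-algebra inherited from `ℝ^X`. -/
abbrev Belief (X : Type*) [Fintype X] : Type _ := stdSimplex ℝ X

/-- `Δ²(X)`: Borel probability measures on `Δ(X)`. -/
abbrev Experiment (X : Type*) [Fintype X] : Type _ := ProbabilityMeasure (Belief X)

/-- The information measure `E_P[H(μ) - H(ν)]` of the experiment `P` at the prior `μ`. -/
def infoMeasure {X : Type*} [Fintype X] (H : C(Belief X, ℝ)) (μ : Belief X)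
    (P : Experiment X) : ℝ :=
  ∫ ν, (H μ - H ν) ∂(P : Measure (Belief X))

/-- The constraints `E_P[ν] = μ` and `E_P[H(μ) - H(ν)] ≤ C`. -/
def Feasible {X : Type*} [Fintype X] (H : C(Belief X, ℝ)) (C : ℝ) (μ : Belief X)
    (P : Experiment X) : Prop :=
  ∫ ν, (ν : X → ℝ) ∂(P : Measure (Belief X)) = (μ : X → ℝ) ∧ infoMeasure H μ P ≤ C

/-- The payoffs `e^{-ρ dt} E_P[V(ν)] - f(E_P[H(μ) - H(ν)])` of the experiments `P` that are
feasible at `μ`. -/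
def continuationPayoffs {X : Type*} [Fintype X] (ρ dt : ℝ) (H : C(Belief X, ℝ)) (f : C(ℝ, ℝ))
    (C : ℝ) (V : C(Belief X, ℝ)) (μ : Belief X) : Set ℝ :=
  {r | ∃ P : Experiment X, Feasible H C μ P ∧
    r = Real.exp (-(ρ * dt)) * ∫ ν, V ν ∂(P : Measure (Belief X)) - f (infoMeasure H μ P)}

/-- `V` solves the Bellman equation: at every `μ`, the supremum `s` of the continuation payoffs
exists in `ℝ` and `V(μ) = max {F(μ), s}`. -/
def SolvesBellman {X : Type*} [Fintype X] (ρ dt : ℝ) (F H : C(Belief X, ℝ)) (f : C(ℝ, ℝ))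
    (C : ℝ) (V : C(Belief X, ℝ)) : Prop :=
  ∀ μ : Belief X, ∃ s : ℝ, IsLUB (continuationPayoffs ρ dt H f C V μ) s ∧ V μ = max (F μ) s

/-- Strict concavity of a function on the simplex. -/
def StrictlyConcave {X : Type*} [Fintype X] (H : C(Belief X, ℝ)) : Prop :=
  ∀ (μ ν ξ : Belief X) (a b : ℝ), μ ≠ ν → 0 < a → 0 < b → a + b = 1 →
    (ξ : X → ℝ) = a • (μ : X → ℝ) + b • (ν : X → ℝ) → a * H μ + b * H ν < H ξ

end InfoDesign

end

namespace InfoDesign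

noncomputable section

open Filter Topology

variable {X : Type*} [Fintype X]

/-! The Bellman operator contracts `C(Belief X, ℝ)` with factor `e^{-ρ dt}`, so Banach's theorem
applies once `value` is known to be continuous. Upper semicontinuity is compactness of `Experiment
X`. For `C > 0`, lower semicontinuity follows from `isOpenMap_barycenter` and
`exists_slack_experiment`: feasible experiments can be perturbed to have slack, then moved to nearby
priors. For `C = 0`, strict concavity leaves only the uninformative experiment (`value_zero`). -/

theorem integrable_continuousMap (P : Experiment X) (g : C(Belief X, ℝ)) :
    Integrable g (P : Measure (Belief X)) :=
  (BoundedContinuousFunction.mkOfCompact g).integrable _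

theorem continuous_integral (g : C(Belief X, ℝ)) :
    Continuous fun P : Experiment X => ∫ ν, g ν ∂(P : Measure (Belief X)) :=
  continuous_iff_continuousAt.2 fun _ =>
    ProbabilityMeasure.tendsto_iff_forall_integral_tendsto.1 tendsto_id
      (BoundedContinuousFunction.mkOfCompact g)

/-- The coordinate function `ν ↦ ν x` on the simplex. -/
def coord (x : X) : C(Belief X, ℝ) :=
  ⟨fun ν => (ν : X → ℝ) x, (continuous_apply x).comp continuous_subtype_val⟩

theorem integrable_coe (P : Experiment X) :
    Integrable (fun ν : Belief X => (ν : X → ℝ)) (P : Measure (Belief X)) :=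
  Integrable.of_eval fun x => integrable_continuousMap P (coord x)

/-- The mean posterior of an experiment. -/
def barycenter (P : Experiment X) : Belief X :=
  ⟨∫ ν, (ν : X → ℝ) ∂(P : Measure (Belief X)),
    (convex_stdSimplex ℝ X).integral_mem (isClosed_stdSimplex ℝ X)
      (Eventually.of_forall fun ν => ν.2) (integrable_coe P)⟩

theorem barycenter_apply (P : Experiment X) (x : X) :
    (barycenter P : X → ℝ) x = ∫ ν, coord x ν ∂(P : Measure (Belief X)) :=
  eval_integral (f := fun ν : Belief X => (ν : X → ℝ))
    (fun i => integrable_continuousMap P (coord i)) x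

theorem continuous_barycenter : Continuous (barycenter : Experiment X → Belief X) := by
  refine Continuous.subtype_mk (f := fun P : Experiment X => (barycenter P : X → ℝ))
    (continuous_pi fun x => ?_) _
  simpa only [barycenter_apply] using continuous_integral (coord x)

theorem infoMeasure_eq (H : C(Belief X, ℝ)) (μ : Belief X) (P : Experiment X) :
    infoMeasure H μ P = H μ - ∫ ν, H ν ∂(P : Measure (Belief X)) := by
  rw [infoMeasure, integral_sub (integrable_const _) (integrable_continuousMap P H)]
  simp

theorem feasible_iff {H : C(Belief X, ℝ)} {C : ℝ} {μ : Belief X} {P : Experiment X} :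
    Feasible H C μ P ↔ barycenter P = μ ∧ infoMeasure H μ P ≤ C :=
  and_congr_left' (Subtype.ext_iff (a1 := barycenter P) (a2 := μ)).symm

/-- The experiment that reveals the posterior `μ` for certain. -/
def certain (μ : Belief X) : Experiment X := ⟨Measure.dirac μ, inferInstance⟩

theorem integral_certain (μ : Belief X) (g : C(Belief X, ℝ)) :
    ∫ ν, g ν ∂(certain μ : Measure (Belief X)) = g μ :=
  integral_dirac _ _

theorem barycenter_certain (μ : Belief X) : barycenter (certain μ) = μ := by
  ext x
  exact (barycenter_apply _ x).trans (integral_certain μ (coord x))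

theorem infoMeasure_certain (H : C(Belief X, ℝ)) (μ : Belief X) :
    infoMeasure H μ (certain μ) = 0 := by
  rw [infoMeasure_eq, integral_certain, sub_self]

/-- The experiment that runs `P` with probability `t` and `Q` with probability `1 - t`. -/
def mix (t : unitInterval) (P Q : Experiment X) : Experiment X :=
  ⟨ENNReal.ofReal t • (P : Measure (Belief X)) + ENNReal.ofReal (1 - t) • (Q : Measure (Belief X)),
    ⟨by
      simp only [Measure.add_apply, Measure.smul_apply, measure_univ, smul_eq_mul, mul_one]
      rw [← ENNReal.ofReal_add t.2.1 (sub_nonneg.2 t.2.2)]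
      simp⟩⟩

theorem integral_mix (t : unitInterval) (P Q : Experiment X) (g : C(Belief X, ℝ)) :
    ∫ ν, g ν ∂(mix t P Q : Measure (Belief X)) =
      t * ∫ ν, g ν ∂(P : Measure (Belief X)) + (1 - t) * ∫ ν, g ν ∂(Q : Measure (Belief X)) := by
  change ∫ ν, g ν ∂(ENNReal.ofReal t • (P : Measure (Belief X)) +
    ENNReal.ofReal (1 - t) • (Q : Measure (Belief X))) = _
  rw [integral_add_measure ((integrable_continuousMap P g).smul_measure ENNReal.ofReal_ne_top)
    ((integrable_continuousMap Q g).smul_measure ENNReal.ofReal_ne_top), integral_smul_measure,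
    integral_smul_measure, ENNReal.toReal_ofReal t.2.1,
    ENNReal.toReal_ofReal (sub_nonneg.2 t.2.2), smul_eq_mul, smul_eq_mul]

theorem mix_one (P Q : Experiment X) : mix 1 P Q = P := by
  apply Subtype.ext
  change ENNReal.ofReal ((1 : unitInterval) : ℝ) • (P : Measure (Belief X)) +
    ENNReal.ofReal (1 - ((1 : unitInterval) : ℝ)) • (Q : Measure (Belief X)) = P
  simp

theorem continuous_mix_certain (P : Experiment X) :
    Continuous fun p : unitInterval × Belief X => mix p.1 P (certain p.2) := by
  refine continuous_iff_continuousAt.2 fun p =>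
    ProbabilityMeasure.tendsto_iff_forall_integral_tendsto.2 fun g => ?_
  have h : Continuous fun p : unitInterval × Belief X =>
      (p.1 : ℝ) * ∫ ν, g ν ∂(P : Measure (Belief X)) + (1 - p.1) * g p.2 := by fun_prop
  refine (h.tendsto p).congr' ?_ |>.trans_eq ?_
  · exact Eventually.of_forall fun q =>
      ((integral_mix q.1 P _ g.toContinuousMap).trans
        (congrArg _ (congrArg _ (integral_certain q.2 g.toContinuousMap)))).symm
  · exact congrArg 𝓝 ((integral_mix p.1 P _ g.toContinuousMap).trans
        (congrArg _ (congrArg _ (integral_certain p.2 g.toContinuousMap)))).symm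

theorem barycenter_mix_certain (t : unitInterval) (P : Experiment X) (ξ : Belief X) (x : X) :
    (barycenter (mix t P (certain ξ)) : X → ℝ) x =
      t * (barycenter P : X → ℝ) x + (1 - t) * (ξ : X → ℝ) x := by
  rw [barycenter_apply, integral_mix, integral_certain, barycenter_apply]
  rfl

/-! ### Openness of the barycenter map. -/

theorem exists_mem_Ioo_of_eventually {p : unitInterval → Prop}
    (h : ∀ᶠ t in 𝓝 (1 : unitInterval), p t) : ∃ t : unitInterval, (t : ℝ) < 1 ∧ p t := by
  have : (𝓝[<] (1 : unitInterval)).NeBot := nhdsLT_neBot_of_exists_lt ⟨0, zero_lt_one⟩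
  obtain ⟨t, hp, ht⟩ := ((h.filter_mono nhdsWithin_le_nhds).and
    (self_mem_nhdsWithin : Set.Iio 1 ∈ 𝓝[<] (1 : unitInterval))).exists
  exact ⟨t, ht, hp⟩

/-- Vanishing coordinates of `μ` impose nothing, so boundary points of the simplex need no separate
treatment. -/
theorem eventually_smul_le (μ : Belief X) {t : ℝ} (h1 : t < 1) :
    ∀ᶠ μ' : Belief X in 𝓝 μ, ∀ x, t * (μ : X → ℝ) x ≤ (μ' : X → ℝ) x := by
  refine eventually_all.2 fun x => ?_
  rcases (stdSimplex.zero_le μ x).eq_or_lt with h | h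
  · exact Eventually.of_forall fun μ' => by rw [← h, mul_zero]; exact μ'.2.1 x
  · have hlt : t * (μ : X → ℝ) x < coord x μ := mul_lt_of_lt_one_left h h1
    exact ((coord x).continuous.tendsto μ).eventually_const_lt hlt |>.mono fun _ => le_of_lt

theorem exists_eq_convexCombination {μ μ' : Belief X} {t : ℝ} (h1 : t < 1)
    (h : ∀ x, t * (μ : X → ℝ) x ≤ (μ' : X → ℝ) x) :
    ∃ ξ : Belief X, ∀ x, (μ' : X → ℝ) x = t * (μ : X → ℝ) x + (1 - t) * (ξ : X → ℝ) x := by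
  have h1' : 0 < 1 - t := sub_pos.2 h1
  refine ⟨⟨fun x => ((μ' : X → ℝ) x - t * (μ : X → ℝ) x) / (1 - t),
    fun x => div_nonneg (sub_nonneg.2 (h x)) h1'.le, ?_⟩, fun x => ?_⟩
  · rw [← Finset.sum_div, Finset.sum_sub_distrib, ← Finset.mul_sum, stdSimplex.sum_eq_one,
      stdSimplex.sum_eq_one, mul_one,
      div_self h1'.ne']
  · change _ = _ + (1 - t) * (((μ' : X → ℝ) x - t * (μ : X → ℝ) x) / (1 - t))
    field_simp
    ring

/-- A prior near that of `P` is a mixture of it with some `ξ`, of weight `1 - t` on `ξ`; mixing `P`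
with `certain ξ` realizes it. -/
theorem isOpenMap_barycenter : IsOpenMap (barycenter : Experiment X → Belief X) := by
  intro U hU
  rw [isOpen_iff_mem_nhds]
  rintro _ ⟨P, hP, rfl⟩
  -- `ξ` depends on `t` and on the target prior, so `t` must work for all `ξ` at once; compactness
  -- of the simplex gives this.
  have key : ∀ᶠ t in 𝓝 (1 : unitInterval), ∀ ξ ∈ (Set.univ : Set (Belief X)),
      mix t P (certain ξ) ∈ U := by
    refine isCompact_univ.eventually_forall_of_forall_eventually fun ξ _ => ?_
    refine (continuous_mix_certain P).continuousAt.eventually (hU.mem_nhds ?_)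
    change mix 1 P (certain ξ) ∈ U
    rwa [mix_one]
  obtain ⟨t, ht, hU⟩ := exists_mem_Ioo_of_eventually key
  filter_upwards [eventually_smul_le (barycenter P) ht] with μ hμ
  obtain ⟨ξ, hξ⟩ := exists_eq_convexCombination ht hμ
  refine ⟨mix t P (certain ξ), hU ξ trivial, ?_⟩
  ext x
  exact (barycenter_mix_certain t P ξ x).trans (hξ x).symm

/-! ### The value of the continuation problem and its continuity. -/

/-- The information of an experiment at its own barycenter. -/
def info (H : C(Belief X, ℝ)) (P : Experiment X) : ℝ := infoMeasure H (barycenter P) P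

/-- The payoff of an experiment run at its own barycenter. -/
def payoff (β : ℝ) (H : C(Belief X, ℝ)) (f : C(ℝ, ℝ)) (V : C(Belief X, ℝ))
    (P : Experiment X) : ℝ :=
  β * ∫ ν, V ν ∂(P : Measure (Belief X)) - f (info H P)

theorem continuous_info (H : C(Belief X, ℝ)) : Continuous (info H) := by
  refine Continuous.congr ?_ fun P => (infoMeasure_eq H (barycenter P) P).symm
  exact (H.continuous.comp continuous_barycenter).sub (continuous_integral H)

theorem continuous_payoff (β : ℝ) (H : C(Belief X, ℝ)) (f : C(ℝ, ℝ)) (V : C(Belief X, ℝ)) :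
    Continuous (payoff β H f V) :=
  (continuous_const.mul (continuous_integral V)).sub (f.continuous.comp (continuous_info H))

theorem info_certain (H : C(Belief X, ℝ)) (μ : Belief X) : info H (certain μ) = 0 := by
  rw [info, barycenter_certain, infoMeasure_certain]

/-- The experiments with barycenter `μ` and information at most `C`. -/
def feasibleSet (H : C(Belief X, ℝ)) (C : ℝ) (μ : Belief X) : Set (Experiment X) :=
  {P | barycenter P = μ ∧ info H P ≤ C}

theorem isCompact_feasibleSet (H : C(Belief X, ℝ)) (C : ℝ) (μ : Belief X) :
    IsCompact (feasibleSet H C μ) :=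
  ((isClosed_singleton.preimage continuous_barycenter).inter
    (isClosed_le (continuous_info H) continuous_const)).isCompact

theorem certain_mem_feasibleSet (H : C(Belief X, ℝ)) {C : ℝ} (hC : 0 ≤ C) (μ : Belief X) :
    certain μ ∈ feasibleSet H C μ :=
  ⟨barycenter_certain μ, (info_certain H μ).trans_le hC⟩

theorem continuationPayoffs_eq_image (ρ dt : ℝ) (H : C(Belief X, ℝ)) (f : C(ℝ, ℝ)) (C : ℝ)
    (V : C(Belief X, ℝ)) (μ : Belief X) :
    continuationPayoffs ρ dt H f C V μ =
      payoff (Real.exp (-(ρ * dt))) H f V '' feasibleSet H C μ := by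
  ext r
  constructor
  · rintro ⟨P, hP, rfl⟩
    obtain ⟨rfl, hI⟩ := feasible_iff.1 hP
    exact ⟨P, ⟨rfl, hI⟩, rfl⟩
  · rintro ⟨P, ⟨rfl, hI⟩, rfl⟩
    exact ⟨P, feasible_iff.2 ⟨rfl, hI⟩, rfl⟩

/-- The supremum of the payoffs of the feasible experiments. -/
def value (β : ℝ) (H : C(Belief X, ℝ)) (f : C(ℝ, ℝ)) (C : ℝ) (V : C(Belief X, ℝ))
    (μ : Belief X) : ℝ :=
  sSup (payoff β H f V '' feasibleSet H C μ)

variable {β C : ℝ} {H V W : C(Belief X, ℝ)} {f : C(ℝ, ℝ)}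

theorem payoff_le_value {P : Experiment X} {μ : Belief X} (hP : P ∈ feasibleSet H C μ) :
    payoff β H f V P ≤ value β H f C V μ :=
  le_csSup ((isCompact_feasibleSet H C μ).bddAbove_image (continuous_payoff β H f V).continuousOn)
    (Set.mem_image_of_mem _ hP)

theorem exists_payoff_eq_value (β : ℝ) (H V : C(Belief X, ℝ)) (f : C(ℝ, ℝ)) (hC : 0 ≤ C)
    (μ : Belief X) : ∃ P ∈ feasibleSet H C μ, payoff β H f V P = value β H f C V μ := by
  obtain ⟨P, hP, h⟩ := (isCompact_feasibleSet H C μ).exists_sSup_image_eq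
    ⟨_, certain_mem_feasibleSet H hC μ⟩ (continuous_payoff β H f V).continuousOn
  exact ⟨P, hP, h.symm⟩

theorem isLUB_value (β : ℝ) (H V : C(Belief X, ℝ)) (f : C(ℝ, ℝ)) (hC : 0 ≤ C) (μ : Belief X) :
    IsLUB (payoff β H f V '' feasibleSet H C μ) (value β H f C V μ) :=
  isLUB_csSup ((Set.nonempty_of_mem (certain_mem_feasibleSet H hC μ)).image _)
    ((isCompact_feasibleSet H C μ).bddAbove_image (continuous_payoff β H f V).continuousOn)

theorem upperSemicontinuous_value (β : ℝ) (H V : C(Belief X, ℝ)) (f : C(ℝ, ℝ)) (hC : 0 ≤ C) :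
    UpperSemicontinuous (value β H f C V) := by
  rw [upperSemicontinuous_iff_isClosed_preimage]
  intro c
  have : value β H f C V ⁻¹' Set.Ici c =
      barycenter '' {P | info H P ≤ C ∧ c ≤ payoff β H f V P} := by
    ext μ
    constructor
    · intro hμ
      obtain ⟨P, ⟨hP, hI⟩, h⟩ := exists_payoff_eq_value β H V f hC μ
      exact ⟨P, ⟨hI, h ▸ hμ⟩, hP⟩
    · rintro ⟨P, ⟨hI, hc⟩, hP⟩
      exact hc.trans (payoff_le_value ⟨hP, hI⟩)
  rw [this]
  exact (((isClosed_le (continuous_info H) continuous_const).inter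
    (isClosed_le continuous_const (continuous_payoff β H f V))).isCompact.image
      continuous_barycenter).isClosed

/-- Mixing with no information at the same prior multiplies the information by `t < 1`, and `t * C <
C`. -/
theorem exists_slack_experiment (hC : 0 < C) {P : Experiment X} (hI : info H P ≤ C)
    {U : Set (Experiment X)} (hU : U ∈ 𝓝 P) :
    ∃ Q ∈ U, barycenter Q = barycenter P ∧ info H Q < C := by
  have hc : Tendsto (fun t => mix t P (certain (barycenter P))) (𝓝 1) (𝓝 P) := by
    have := ((continuous_mix_certain P).comp
      (continuous_id.prodMk (continuous_const (y := barycenter P)))).tendsto 1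
    simpa [Function.comp_def, mix_one] using this
  obtain ⟨t, ht, hQ⟩ := exists_mem_Ioo_of_eventually (hc.eventually hU)
  have hb : barycenter (mix t P (certain (barycenter P))) = barycenter P := by
    ext x
    refine (barycenter_mix_certain t P _ x).trans ?_
    change _ = (barycenter P : X → ℝ) x
    ring
  refine ⟨_, hQ, hb, ?_⟩
  have h : info H (mix t P (certain (barycenter P))) = t * info H P := by
    rw [info, info, hb, infoMeasure_eq, infoMeasure_eq, integral_mix, integral_certain]
    ring
  rw [h]
  nlinarith [mul_le_mul_of_nonneg_left hI t.2.1]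

theorem lowerSemicontinuous_value (β : ℝ) (H V : C(Belief X, ℝ)) (f : C(ℝ, ℝ)) (hC : 0 < C) :
    LowerSemicontinuous (value β H f C V) := by
  rw [lowerSemicontinuous_iff_isOpen_preimage]
  intro c
  have : value β H f C V ⁻¹' Set.Ioi c =
      barycenter '' {P | info H P < C ∧ c < payoff β H f V P} := by
    ext μ
    constructor
    · intro hμ
      obtain ⟨P, ⟨rfl, hI⟩, h⟩ := exists_payoff_eq_value β H V f hC.le μ
      obtain ⟨Q, hQ, hb, hlt⟩ := exists_slack_experiment hC hI
        ((isOpen_lt continuous_const (continuous_payoff β H f V)).mem_nhds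
          (show c < payoff β H f V P from h ▸ hμ))
      exact ⟨Q, ⟨hlt, hQ⟩, hb⟩
    · rintro ⟨P, ⟨hI, hc⟩, hP⟩
      exact lt_of_lt_of_le hc (payoff_le_value ⟨hP, hI.le⟩)
  rw [this]
  exact isOpenMap_barycenter _ ((isOpen_lt (continuous_info H) continuous_const).inter
    (isOpen_lt continuous_const (continuous_payoff β H f V)))

/-- This is the equality case of Jensen's inequality: `P` must be concentrated at its barycenter. -/
theorem integral_eq_of_info_nonpos (hH : StrictlyConcave H) {P : Experiment X}
    (hI : info H P ≤ 0) (g : C(Belief X, ℝ)) :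
    ∫ ν, g ν ∂(P : Measure (Belief X)) = g (barycenter P) := by
  classical
  -- Jensen is applied in the ambient space `X → ℝ`; the value 0 off the simplex plays no role.
  let h : (X → ℝ) → ℝ := fun v => if hv : v ∈ stdSimplex ℝ X then H ⟨v, hv⟩ else 0
  have h_coe : ∀ ν : Belief X, h ν = H ν := fun ν => dif_pos ν.2
  have h_concave : StrictConcaveOn ℝ (stdSimplex ℝ X) h := by
    refine ⟨convex_stdSimplex ℝ X, fun v hv w hw hne a b ha hb hab => ?_⟩
    have := hH ⟨v, hv⟩ ⟨w, hw⟩ ⟨_, convex_stdSimplex ℝ X hv hw ha.le hb.le hab⟩ a b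
      (fun e => hne (congrArg Subtype.val e)) ha hb hab rfl
    rw [← h_coe, ← h_coe, ← h_coe] at this
    exact this
  have h_cont : ContinuousOn h (stdSimplex ℝ X) := by
    rw [continuousOn_iff_continuous_domRestrict]
    exact H.continuous.congr fun ν => (h_coe ν).symm
  have hcomp : (h ∘ fun ν : Belief X => (ν : X → ℝ)) = H := funext h_coe
  rcases h_concave.ae_eq_const_or_lt_map_average (μ := (P : Measure (Belief X))) h_cont
    (isClosed_stdSimplex ℝ X) (Eventually.of_forall fun ν => ν.2) (integrable_coe P)
    (hcomp ▸ integrable_continuousMap P H) with hae | hlt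
  · rw [average_eq_integral] at hae
    have : g =ᵐ[(P : Measure (Belief X))] fun _ => g (barycenter P) := by
      filter_upwards [hae] with ν hν
      exact congrArg g (Subtype.ext hν)
    rw [integral_congr_ae this]
    simp
  · rw [average_eq_integral, average_eq_integral] at hlt
    have hi : ∫ ν : Belief X, h ν ∂(P : Measure (Belief X)) =
        ∫ ν, H ν ∂(P : Measure (Belief X)) := integral_congr_ae (Eventually.of_forall h_coe)
    have hb : h (∫ ν, (ν : X → ℝ) ∂(P : Measure (Belief X))) = H (barycenter P) :=
      h_coe (barycenter P)
    have hlt : H (barycenter P) > ∫ ν, H ν ∂(P : Measure (Belief X)) := by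
      rw [← hi, ← hb]
      exact hlt
    rw [info, infoMeasure_eq] at hI
    linarith

theorem value_zero (hH : StrictlyConcave H) (μ : Belief X) :
    value β H f 0 V μ = β * V μ - f 0 := by
  obtain ⟨P, ⟨rfl, hI⟩, h⟩ := exists_payoff_eq_value β H V f le_rfl μ
  rw [← h, payoff, info, infoMeasure_eq, integral_eq_of_info_nonpos hH hI,
    integral_eq_of_info_nonpos hH hI, sub_self]

theorem continuous_value (β : ℝ) (V : C(Belief X, ℝ)) (f : C(ℝ, ℝ)) (hC : 0 ≤ C)
    (hH : C = 0 → StrictlyConcave H) : Continuous (value β H f C V) := by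
  rcases hC.eq_or_lt with rfl | hC
  · rw [funext (value_zero (hH rfl))]
    fun_prop
  · exact continuous_iff_lower_upperSemicontinuous.2
      ⟨lowerSemicontinuous_value β H V f hC, upperSemicontinuous_value β H V f hC.le⟩

/-! ### Contraction and the fixed point. -/

/-- An optimal experiment for `V` is also feasible for `W`, at the same information cost. -/
theorem value_le_value_add (hβ : 0 ≤ β) (hC : 0 ≤ C) (μ : Belief X) :
    value β H f C V μ ≤ value β H f C W μ + β * dist V W := by
  obtain ⟨P, hP, h⟩ := exists_payoff_eq_value β H V f hC μ
  have hle : ∫ ν, V ν ∂(P : Measure (Belief X)) ≤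
      ∫ ν, W ν ∂(P : Measure (Belief X)) + dist V W := by
    have : ∫ ν, V ν ∂(P : Measure (Belief X)) ≤
        ∫ ν, (W ν + dist V W) ∂(P : Measure (Belief X)) := by
      refine integral_mono (integrable_continuousMap P V)
        ((integrable_continuousMap P W).add (integrable_const _)) fun ν => ?_
      have := (le_abs_self _).trans (ContinuousMap.dist_apply_le_dist (f := V) (g := W) ν)
      change V ν ≤ W ν + dist V W
      linarith
    rwa [integral_add (integrable_continuousMap P W) (integrable_const _), integral_const,
      probReal_univ, one_smul] at this
  have hP' := payoff_le_value (β := β) (f := f) (V := W) hP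
  have := mul_le_mul_of_nonneg_left hle hβ
  rw [← h]
  rw [payoff] at hP' ⊢
  linarith

theorem abs_value_sub_value_le (hβ : 0 ≤ β) (hC : 0 ≤ C) (μ : Belief X) :
    |value β H f C V μ - value β H f C W μ| ≤ β * dist V W := by
  have h1 := value_le_value_add (H := H) (f := f) (V := V) (W := W) hβ hC μ
  have h2 := value_le_value_add (H := H) (f := f) (V := W) (W := V) hβ hC μ
  rw [dist_comm] at h2
  exact abs_sub_le_iff.2 ⟨by linarith, by linarith⟩

/-- The Bellman operator `V ↦ max {F, value V}`. -/
def bellman (β : ℝ) (F : C(Belief X, ℝ)) (f : C(ℝ, ℝ)) (hC : 0 ≤ C)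
    (hH : C = 0 → StrictlyConcave H) (V : C(Belief X, ℝ)) : C(Belief X, ℝ) :=
  F ⊔ ⟨value β H f C V, continuous_value β V f hC hH⟩

theorem contractingWith_bellman (hβ : 0 ≤ β) (hβ1 : β < 1) (F : C(Belief X, ℝ)) (f : C(ℝ, ℝ))
    (hC : 0 ≤ C) (hH : C = 0 → StrictlyConcave H) :
    ContractingWith ⟨β, hβ⟩ (bellman β F f hC hH) := by
  refine ⟨hβ1, LipschitzWith.of_dist_le_mul fun V W => ?_⟩
  refine (ContinuousMap.dist_le (mul_nonneg hβ dist_nonneg)).2 fun μ => ?_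
  refine le_trans ?_ (abs_value_sub_value_le (H := H) (f := f) hβ hC μ)
  exact abs_max_sub_max_le_abs _ _ (F μ) |> fun h => by
    simpa [Real.dist_eq, bellman, max_comm] using h

theorem solvesBellman_iff_isFixedPt (ρ dt : ℝ) (F : C(Belief X, ℝ)) (f : C(ℝ, ℝ)) (hC : 0 ≤ C)
    (hH : C = 0 → StrictlyConcave H) (V : C(Belief X, ℝ)) :
    SolvesBellman ρ dt F H f C V ↔
      Function.IsFixedPt (bellman (Real.exp (-(ρ * dt))) F f hC hH) V := by
  rw [Function.IsFixedPt, ContinuousMap.ext_iff]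
  refine forall_congr' fun μ => ?_
  rw [continuationPayoffs_eq_image]
  have hlub := isLUB_value (Real.exp (-(ρ * dt))) H V f hC μ
  constructor
  · rintro ⟨s, hs, hV⟩
    rw [hV, hs.unique hlub]
    rfl
  · exact fun h => ⟨_, hlub, h.symm⟩

end

end InfoDesign

theorem mainTheorem9 {X : Type*} [Fintype X] [Nonempty X]
    (ρ dt : ℝ) (hρ : 0 < ρ) (hdt : 0 < dt)
    (F H : C(InfoDesign.Belief X, ℝ)) (f : C(ℝ, ℝ)) (C : ℝ)
    (hF : ∀ μ, 0 ≤ F μ) (hf : ∀ x, 0 ≤ f x) (hC : 0 ≤ C)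
    (hH : C = 0 → InfoDesign.StrictlyConcave H) :
    ∃! V : C(InfoDesign.Belief X, ℝ), InfoDesign.SolvesBellman ρ dt F H f C V := by
  have hcontr := InfoDesign.contractingWith_bellman (Real.exp_nonneg (-(ρ * dt)))
    (Real.exp_lt_one_iff.2 (neg_neg_of_pos (mul_pos hρ hdt))) F f hC hH
  simp only [InfoDesign.solvesBellman_iff_isFixedPt ρ dt F f hC hH]
  exact ⟨_, hcontr.fixedPoint_isFixedPt, fun V hV => hcontr.fixedPoint_unique hV⟩
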